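/- Let $q$ be a power of an odd prime, let $n=(q^2+1)/2$, and let $F=\mathbb F_{q^2}$. For a matrix $G(D)=(g_{rj})\in F[D]^{k\times n}$ put $\gamma_r=\max_j\deg g_{rj}$. The matrix is called basic if it has a polynomial right inverse, and reduced basic if moreover $\sum_r\gamma_r$ is smallest among all basic matrices generating the same submodule of $F[D]^n$. A convolutional code over $F$ with parameters $(n,k,\gamma;\mu,d_f)$ is a submodule $V=\{u(D)G(D) : u(D)\in F[D]^k\}$ of $F[D]^n$ with $G(D)\in F[D]^{k\times n}$ reduced basic, where $\gamma=\sum_r\gamma_r$, $\mu=\max_r\gamma_r$, and $d_f$ is the minimum weight (total number of nonzero coefficients) of a nonzero element of $V$. It is called MDS if $d_f=(n-k)(\lfloor\gamma/k\rfloor+1)+\gamma+1$. Then for every integer $i$ with $2\le i\le (n-1)/2$ there is an MDS convolutional code over $\mathbb F_{q^2}$ with parameters $$(n,\;n-2i+2,\;2;\;1,\;2i+1).$$ Moreover, such a code can be obtained from negacyclic BCH codes as follows. There are a primitive $2n$-th root of unity $\beta$ in an algebraic closure of $F$ and matrices $H_1\in F^{(2i-2)\times n}$ and $H_0\in F^{2\times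 n}$ such that, with $M^{(j)}$ the minimal polynomial of $\beta^j$ over $F$, the matrices $H_1$, $H_0$ and $\begin{bmatrix}H_1\\H_0\end{bmatrix}$ have linearly independent rows and are parity-check matrices of the negacyclic codes of length $n$ over $F$ (ideals of $F[x]/(x^n+1)$) generated by $M^{(1)}M^{(3)}\cdots M^{(2i-3)}$, by $M^{(2i-1)}$ and by $M^{(1)}M^{(3)}\cdots M^{(2i-1)}$, respectively, and the code is the Hermitian dual of the submodule $W$ of $F[D]^n$ generated by the rows of $H_1+\tilde H_0D$. Here $\tilde H_0$ is $H_0$ with zero rows added at the bottom to make $2i-2$ rows, and the Hermitian dual of $W$ is the set of all $u(D)\in F[D]^n$ such that $\langle f(D)u(D)\mid w(D)\rangle=0$ for all $f(D)\in F[D]$ and $w(D)\in W$, where $\langle u(D)\mid w(D)\rangle=\sum_t u_t\cdot w_t^{\,q}$ and $u_t,w_t\in F^n$ are the coefficient vectors of $D^t$. -/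

import Mathlib

open scoped Polynomial

namespace ConvCode

noncomputable section

/-! ### Convolutional codes -/

/-- `γ_i`, the largest degree of an entry of the `i`-th row of a polynomial matrix. -/
def rowDegree {F : Type*} [Field F] {k n : ℕ} (G : Matrix (Fin k) (Fin n) F[X]) (i : Fin k) : ℕ :=
  Finset.univ.sup fun j => (G i j).natDegree

/-- The overall constraint length `γ = ∑ i, γ_i`. -/
def constraintLength {F : Type*} [Field F] {k n : ℕ} (G : Matrix (Fin k) (Fin n) F[X]) : ℕ :=
  ∑ i, rowDegree G i

/-- The memory `μ = max_i γ_i`. -/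
def memory {F : Type*} [Field F] {k n : ℕ} (G : Matrix (Fin k) (Fin n) F[X]) : ℕ :=
  Finset.univ.sup (rowDegree G)

/-- The submodule `{u(D) G(D)}` of `F[D]^n` generated by a polynomial matrix. -/
def generatedCode {F : Type*} [Field F] {k n : ℕ} (G : Matrix (Fin k) (Fin n) F[X]) :
    Submodule F[X] (Fin n → F[X]) :=
  LinearMap.range G.vecMulLinear

/-- A basic matrix: it has a polynomial right inverse. -/
def IsBasic {F : Type*} [Field F] {k n : ℕ} (G : Matrix (Fin k) (Fin n) F[X]) : Prop :=
  ∃ R : Matrix (Fin n) (Fin k) F[X], G * R = 1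

/-- A reduced basic matrix: its overall constraint length is the smallest one among all
basic generator matrices of the code that it generates. -/
def IsReducedBasic {F : Type*} [Field F] {k n : ℕ} (G : Matrix (Fin k) (Fin n) F[X]) : Prop :=
  IsBasic G ∧ ∀ G' : Matrix (Fin k) (Fin n) F[X],
    IsBasic G' → generatedCode G' = generatedCode G → constraintLength G ≤ constraintLength G'

/-- The weight of a vector of polynomials: the number of nonzero coefficients. -/
def weight {F : Type*} [Field F] {n : ℕ} (v : Fin n → F[X]) : ℕ :=
  ∑ j, (v j).support.card

/-- `V` has free distance `d`. -/
def HasFreeDistance {F : Type*} [Field F] {n : ℕ} (V : Submodule F[X] (Fin n → F[X])) (d : ℕ) :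
    Prop :=
  IsLeast {w : ℕ | ∃ v ∈ V, v ≠ 0 ∧ weight v = w} d

/-- `V` is a convolutional code with parameters `(n, k, γ; μ, d)`. -/
def IsConvolutionalCode {F : Type*} [Field F] {n : ℕ} (V : Submodule F[X] (Fin n → F[X]))
    (k γ μ d : ℕ) : Prop :=
  (∃ G : Matrix (Fin k) (Fin n) F[X], IsReducedBasic G ∧ generatedCode G = V ∧
    constraintLength G = γ ∧ memory G = μ) ∧ HasFreeDistance V d

/-- `V` is an MDS convolutional code with parameters `(n, k, γ; μ, d)`: the generalized Singleton
bound `d ≤ (n - k) (⌊γ / k⌋ + 1) + γ + 1` holds with equality. -/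
def IsMDSConvolutionalCode {F : Type*} [Field F] {n : ℕ} (V : Submodule F[X] (Fin n → F[X]))
    (k γ μ d : ℕ) : Prop :=
  IsConvolutionalCode V k γ μ d ∧ d = (n - k) * (γ / k + 1) + γ + 1

/-- The Hermitian form `⟨u(D) | v(D)⟩ = ∑_t u_t · v_t^q` on `F[D]^n`, where `|F| = q²` and
`u_t`, `v_t` are the coefficient vectors of `D^t`. -/
def hermitianForm {F : Type*} [Field F] (q : ℕ) {n : ℕ} (u v : Fin n → F[X]) : F :=
  ∑ j, (u j).sum fun t a => a * (v j).coeff t ^ q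

theorem hermitianForm_add {F : Type*} [Field F] (q : ℕ) {n : ℕ} (u u' v : Fin n → F[X]) :
    hermitianForm q (u + u') v = hermitianForm q u v + hermitianForm q u' v := by
  unfold hermitianForm
  rw [← Finset.sum_add_distrib]
  refine Finset.sum_congr rfl fun j _ => ?_
  exact Polynomial.sum_add_index _ _ _ (fun t => by simp) (fun t a b => by ring)

/-- The Hermitian dual of `V`: the vectors `u(D)` all of whose polynomial multiples are orthogonal
to `V`, i.e. the largest `F[D]`-submodule of the orthogonal complement of `V` (for a code `V`,
this says that `u(D)` is orthogonal to all forward and backward time shifts of `V`). -/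
def hermitianDual {F : Type*} [Field F] (q : ℕ) {n : ℕ} (V : Submodule F[X] (Fin n → F[X])) :
    Submodule F[X] (Fin n → F[X]) where
  carrier := {u | ∀ f : F[X], ∀ v ∈ V, hermitianForm q (f • u) v = 0}
  zero_mem' := by
    intro f v _
    simp [hermitianForm]
  add_mem' := by
    intro a b ha hb f v hv
    rw [smul_add, hermitianForm_add, ha f v hv, hb f v hv, add_zero]
  smul_mem' := by
    intro c u hu f v hv
    rw [smul_smul]
    exact hu (f * c) v hv

/-! ### Negacyclic codes -/

/-- The polynomial `c_0 + c_1 x + ⋯ + c_{n-1} x^{n-1}` of a vector. -/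
def vecPoly {F : Type*} [Field F] {n : ℕ} : (Fin n → F) →ₗ[F] F[X] :=
  ∑ t : Fin n, (Polynomial.monomial (t : ℕ)).comp (LinearMap.proj t)

/-- The negacyclic code of length `n` generated by `g`: the vectors whose polynomial lies in the
ideal of `F[x] / (x^n + 1)` generated by the class of `g`. -/
def negacyclicCode {F : Type*} [Field F] (n : ℕ) (g : F[X]) : Submodule F (Fin n → F) :=
  (((Ideal.span {Ideal.Quotient.mk (Ideal.span {(Polynomial.X ^ n + 1 : F[X])}) g}).comap
    (Ideal.Quotient.mk (Ideal.span {(Polynomial.X ^ n + 1 : F[X])}))).restrictScalars F).comap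
    vecPoly

open Classical in
/-- `lcm (M^(b), M^(b+2), …, M^(b+2(δ-2)))`, where `M^(j)` is the minimal polynomial of `β^j` over
`F`. These are monic irreducible polynomials, so the lcm is the product of the distinct ones. -/
def bchGenerator (F : Type*) [Field F] {K : Type*} [Field K] [Algebra F K] (β : K) (b δ : ℕ) :
    F[X] :=
  ∏ P ∈ (Finset.range (δ - 1)).image fun t => minpoly F (β ^ (b + 2 * t)), P

/-- The negacyclic BCH code over `F` of length `n` and designed distance `δ` with respect to `β`
(a primitive `2n`-th root of unity) and the odd number `b`. -/
def negacyclicBCH (F : Type*) [Field F] {K : Type*} [Field K] [Algebra F K] (n : ℕ) (β : K)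
    (b δ : ℕ) : Submodule F (Fin n → F) :=
  negacyclicCode n (bchGenerator F β b δ)

/-- `H` is a parity-check matrix of the block code `B` (with linearly independent rows). -/
def IsParityCheck {F : Type*} [Field F] {ι : Type*} {n : ℕ} (H : Matrix ι (Fin n) F)
    (B : Submodule F (Fin n → F)) : Prop :=
  LinearIndependent F H.row ∧ ∀ c : Fin n → F, c ∈ B ↔ H.mulVec c = 0

/-- The matrix with `r` rows obtained from `H` by adding zero rows at the bottom. -/
def padRows {F : Type*} [Field F] {s n : ℕ} (r : ℕ) (H : Matrix (Fin s) (Fin n) F) :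
    Matrix (Fin r) (Fin n) F :=
  fun i j => if h : (i : ℕ) < s then H ⟨i, h⟩ j else 0

/-- The polynomial matrix `A + B D`. -/
def unitMemoryMatrix {F : Type*} [Field F] {r n : ℕ} (A B : Matrix (Fin r) (Fin n) F) :
    Matrix (Fin r) (Fin n) F[X] :=
  A.map Polynomial.C + (Polynomial.X : F[X]) • B.map Polynomial.C

end

end ConvCode

/-! Since `|F| + 1 = 2n`, a primitive `2n`-th root of unity `β` satisfies `β ^ |F| = β⁻¹`. Hence for
`0 < j < n` the minimal polynomial of `β ^ j` is the quadratic with roots `β ^ (±j)`. The zeros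
attached to `1, 3, …, 2m - 1` thus include `β ^ e` for the `2m` consecutive odd exponents `e` from
`-(2m - 1)` to `2m - 1`. So the BCH bound gives distance at least `2m + 1` (`bch_bound`), while in
the range used the generator has degree only `2m`.

The Hermitian dual is the kernel of the Frobenius conjugate of `H̃₀ + H₁ D`
(`mem_hermitianDual_unitMemoryMatrix`). For a nonzero `u(D)` in it, the first nonzero coefficient is
killed by the conjugate of `H₀` and the last by that of `H₁`. If the two coincide, the weight is at
least `2i + 1`; otherwise it is at least `2 + (2i - 1)`. The generator polynomial, conjugated and
read as a constant vector, attains the bound (`hasFreeDistance_of_kernel`).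

Completing the stacked parity checks to a basis of `F ^ n` turns the kernel equations into `y_B = -D
y_A`, which gives a basic generator matrix with two rows of degree one and the others constant. It
is reduced because constant rows of a basic generator matrix are independent elements of the block
code with both parity checks, so there are at most `n - 2i` of them (`card_constant_rows_le`). -/

namespace ConvCode

open Polynomial Matrix

/-! ### Reduced basic generator matrices of kernels of unit-memory matrices. -/

section GeneratorMatrix

variable {F : Type*} [Field F]

/-- Extending the rows of `M` to a basis gives new coordinates `y = T u` on `F ^ n`, with inverse
`S`, in which the parity checks become coordinate functions. -/
theorem exists_invertible_completion {ι : Type*} [Fintype ι] [DecidableEq ι] {n m : ℕ}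
    (M : Matrix ι (Fin n) F) (hM : LinearIndependent F M.row) (h : Fintype.card ι + m = n) :
    ∃ (T : Matrix (ι ⊕ Fin m) (Fin n) F) (S : Matrix (Fin n) (ι ⊕ Fin m) F),
      (∀ i, T (Sum.inl i) = M i) ∧ T * S = 1 ∧ S * T = 1 := by
  classical
  let b := Module.Basis.sumExtend hM
  have hb : ∀ i, b (Sum.inl i) = M i := fun i => by
    simp only [b, Module.Basis.sumExtend, Module.Basis.reindex_apply]
    exact Module.Basis.extend_apply_self _ _
  have : Finite (ι ⊕ Module.Basis.sumExtendIndex hM) := Module.Finite.finite_basis b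
  have : Finite (Module.Basis.sumExtendIndex hM) := Finite.sum_right ι
  let _ := Fintype.ofFinite (Module.Basis.sumExtendIndex hM)
  have hc : Fintype.card (Module.Basis.sumExtendIndex hM) = m := by
    have := Module.finrank_eq_card_basis b
    rw [Module.finrank_fin_fun, Fintype.card_sum] at this
    omega
  let e := Fintype.equivFinOfCardEq hc
  let b' := b.reindex (Equiv.sumCongr (Equiv.refl ι) e)
  have hb' : ∀ i, b' (Sum.inl i) = M i := fun i => by simp [b', hb]
  refine ⟨((Pi.basisFun F (Fin n)).toMatrix b')ᵀ, (b'.toMatrix (Pi.basisFun F (Fin n)))ᵀ,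
    fun i => ?_, ?_, ?_⟩
  · ext j
    simp [Module.Basis.toMatrix_apply, hb']
  · rw [← Matrix.transpose_mul, Module.Basis.toMatrix_mul_toMatrix_flip, Matrix.transpose_one]
  · rw [← Matrix.transpose_mul, Module.Basis.toMatrix_mul_toMatrix_flip, Matrix.transpose_one]

theorem padRows_mulVec {r s n : ℕ} (B : Matrix (Fin s) (Fin n) F) (v : Fin n → F) (a : Fin r) :
    (padRows r B *ᵥ v) a = if h : (a : ℕ) < s then (B *ᵥ v) ⟨a, h⟩ else 0 := by
  by_cases h : (a : ℕ) < s <;> simp [padRows, mulVec, dotProduct, h]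

theorem padRows_mulVec_eq_zero_iff {r s n : ℕ} (hs : s ≤ r) (B : Matrix (Fin s) (Fin n) F)
    (v : Fin n → F) : padRows r B *ᵥ v = 0 ↔ B *ᵥ v = 0 := by
  constructor
  · intro h
    ext j
    have := congrFun h (Fin.castLE hs j)
    simpa [padRows_mulVec] using this
  · intro h
    ext a
    rw [padRows_mulVec, h]
    simp

theorem unitMemoryMatrix_mulVec {r n : ℕ} (P A : Matrix (Fin r) (Fin n) F) (u : Fin n → F[X]) :
    unitMemoryMatrix P A *ᵥ u = P.map (C (R := F)) *ᵥ u + (X : F[X]) • (A.map (C (R := F)) *ᵥ u) := by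
  rw [unitMemoryMatrix, add_mulVec, smul_mulVec]

theorem map_C_mulVec_coeff {ι : Type*} {n : ℕ} (A : Matrix ι (Fin n) F) (u : Fin n → F[X])
    (a : ι) (t : ℕ) :
    ((A.map (C (R := F)) *ᵥ u) a).coeff t = (A *ᵥ fun j => (u j).coeff t) a := by
  simp [mulVec, dotProduct, coeff_C_mul]

theorem padRows_map_mulVec {r s n : ℕ} (B : Matrix (Fin s) (Fin n) F) (u : Fin n → F[X])
    (a : Fin r) :
    ((padRows r B).map (C (R := F)) *ᵥ u) a =
      if h : (a : ℕ) < s then (B.map (C (R := F)) *ᵥ u) ⟨a, h⟩ else 0 := by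
  by_cases h : (a : ℕ) < s <;> simp [padRows, mulVec, dotProduct, h]

/-- The selection matrix describing, in the coordinates `(y_A, y_B, z)`, the solutions of
`y_B = - D y_A` (for the first coordinates of `y_A`, the other ones being zero). -/
noncomputable def shiftRows (F : Type*) [Field F] {r s : ℕ} (hs : s ≤ r) (m : ℕ) :
    Matrix (Fin s ⊕ Fin m) ((Fin r ⊕ Fin s) ⊕ Fin m) F[X] :=
  Matrix.of (Sum.elim
    (fun j => (Pi.single (Sum.inl (Sum.inl (Fin.castLE hs j))) 1 -
      (X : F[X]) • Pi.single (Sum.inl (Sum.inr j)) 1 : (Fin r ⊕ Fin s) ⊕ Fin m → F[X]))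
    (fun l => Pi.single (Sum.inr l) 1))

theorem vecMul_shiftRows_inl_inl {r s : ℕ} (hs : s ≤ r) (m : ℕ) (w : Fin s ⊕ Fin m → F[X])
    (a : Fin r) :
    (w ᵥ* shiftRows F hs m) (Sum.inl (Sum.inl a)) =
      if h : (a : ℕ) < s then w (Sum.inl ⟨a, h⟩) else 0 := by
  simp only [vecMul, dotProduct, shiftRows, Fintype.sum_sum_type, of_apply, Sum.elim_inl,
    Sum.elim_inr, Pi.sub_apply, Pi.smul_apply, Pi.single_apply, Sum.inl.injEq, reduceCtorEq,
    if_false, smul_zero, sub_zero, mul_zero, Finset.sum_const_zero, add_zero, mul_ite, mul_one]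
  split_ifs with h
  · rw [Finset.sum_eq_single ⟨a, h⟩]
    · simp
    · intro b _ hb
      rw [if_neg]
      intro h'
      exact hb (Fin.ext (by simp [h']))
    · simp
  · refine Finset.sum_eq_zero fun b _ => if_neg fun h' => h ?_
    rw [h']
    exact b.2

theorem vecMul_shiftRows_inl_inr {r s : ℕ} (hs : s ≤ r) (m : ℕ) (w : Fin s ⊕ Fin m → F[X])
    (b : Fin s) :
    (w ᵥ* shiftRows F hs m) (Sum.inl (Sum.inr b)) = -(X * w (Sum.inl b)) := by
  simp [vecMul, dotProduct, shiftRows, Pi.single_apply, mul_comm]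

theorem vecMul_shiftRows_inr {r s : ℕ} (hs : s ≤ r) (m : ℕ) (w : Fin s ⊕ Fin m → F[X])
    (l : Fin m) : (w ᵥ* shiftRows F hs m) (Sum.inr l) = w (Sum.inr l) := by
  simp [vecMul, dotProduct, shiftRows, Pi.single_apply]

/-- Restricted to the free coordinates (the first `s` of `y_A`, and `z`), `shiftRows` is the
identity; selecting those columns is therefore a polynomial right inverse. -/
theorem shiftRows_mul_selection {r s : ℕ} (hs : s ≤ r) (m : ℕ) :
    shiftRows F hs m * (Matrix.of fun (c : (Fin r ⊕ Fin s) ⊕ Fin m) (i : Fin s ⊕ Fin m) =>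
      if c = Sum.map (fun j => Sum.inl (Fin.castLE hs j)) id i then (1 : F[X]) else 0) = 1 := by
  ext i i' : 2
  simp only [mul_apply, of_apply, mul_ite, mul_one, mul_zero, Finset.sum_ite_eq',
    Finset.mem_univ, if_true]
  rcases i with j | l <;> rcases i' with j' | l' <;>
    simp [shiftRows, Pi.single_apply, one_apply, eq_comm]

/-- Membership in the kernel of `B̃ + A D`, in the coordinates given by a matrix `T` whose first
rows are those of `A` and `B`. -/
theorem unitMemoryMatrix_mulVec_eq_zero_iff {r s n m : ℕ} (hs : s ≤ r)
    (A : Matrix (Fin r) (Fin n) F) (B : Matrix (Fin s) (Fin n) F)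
    (T : Matrix ((Fin r ⊕ Fin s) ⊕ Fin m) (Fin n) F)
    (hT : ∀ i, T (Sum.inl i) = fromRows A B i) (u : Fin n → F[X]) :
    unitMemoryMatrix (padRows r B) A *ᵥ u = 0 ↔
      ∃ w : Fin s ⊕ Fin m → F[X], w ᵥ* shiftRows F hs m = T.map (C (R := F)) *ᵥ u := by
  have hA : ∀ a, (T.map (C (R := F)) *ᵥ u) (Sum.inl (Sum.inl a)) = (A.map (C (R := F)) *ᵥ u) a := fun a => by
    simp [mulVec, dotProduct, hT]
  have hB : ∀ a, (T.map (C (R := F)) *ᵥ u) (Sum.inl (Sum.inr a)) = (B.map (C (R := F)) *ᵥ u) a := fun a => by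
    simp [mulVec, dotProduct, hT]
  rw [unitMemoryMatrix_mulVec]
  constructor
  · intro h
    have h' : ∀ a : Fin r, (if h : (a : ℕ) < s then (B.map (C (R := F)) *ᵥ u) ⟨a, h⟩ else 0) +
        X * (A.map (C (R := F)) *ᵥ u) a = 0 := fun a => by
      have := congrFun h a
      rwa [Pi.add_apply, padRows_map_mulVec] at this
    -- The free parameters are the first `s` coordinates of `y_A` and all of `z`. The remaining
    -- coordinates of `y_A` vanish by cancelling `X`.
    refine ⟨Sum.elim (fun j => (A.map (C (R := F)) *ᵥ u) (Fin.castLE hs j))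
      (fun l => (T.map (C (R := F)) *ᵥ u) (Sum.inr l)), ?_⟩
    ext c : 1
    rcases c with (a | b) | l
    · rw [vecMul_shiftRows_inl_inl, hA]
      have := h' a
      split_ifs at this ⊢ with hlt
      · rfl
      · exact ((mul_eq_zero.1 ((zero_add _).symm.trans this)).resolve_left X_ne_zero).symm
    · rw [vecMul_shiftRows_inl_inr, hB]
      have := h' (Fin.castLE hs b)
      simp only [Fin.val_castLE, Fin.is_lt, dite_true, Fin.eta] at this
      rw [Sum.elim_inl]
      exact (eq_neg_of_add_eq_zero_left this).symm
    · rw [vecMul_shiftRows_inr, Sum.elim_inr]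
  · rintro ⟨w, hw⟩
    ext a : 1
    rw [Pi.add_apply, padRows_map_mulVec, Pi.smul_apply, ← hA, ← hw, vecMul_shiftRows_inl_inl]
    split_ifs with h
    · rw [← hB, ← hw, vecMul_shiftRows_inl_inr]
      simp
    · simp

/-- A generator matrix of the kernel of `B̃ + A D`. -/
noncomputable def kernelGenerator {r s n m : ℕ} (hs : s ≤ r) (S : Matrix (Fin n) ((Fin r ⊕ Fin s) ⊕ Fin m) F) :
    Matrix (Fin (s + m)) (Fin n) F[X] :=
  (shiftRows F hs m * (S.map (C (R := F)))ᵀ).submatrix finSumFinEquiv.symm id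

theorem map_C_mul_map_C_eq_one {ι κ : Type*} [Fintype κ] [DecidableEq ι] {T : Matrix ι κ F}
    {S : Matrix κ ι F} (h : T * S = 1) : T.map (C : F →+* F[X]) * S.map (C : F →+* F[X]) = 1 := by
  rw [← Matrix.map_mul, h, Matrix.map_one _ (map_zero _) (map_one _)]

theorem isBasic_kernelGenerator {r s n m : ℕ} (hs : s ≤ r)
    {T : Matrix ((Fin r ⊕ Fin s) ⊕ Fin m) (Fin n) F}
    {S : Matrix (Fin n) ((Fin r ⊕ Fin s) ⊕ Fin m) F} (h : T * S = 1) :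
    IsBasic (kernelGenerator hs S) := by
  refine ⟨((T.map (C (R := F)))ᵀ * (Matrix.of fun (c : (Fin r ⊕ Fin s) ⊕ Fin m) (i : Fin s ⊕ Fin m) =>
      if c = Sum.map (fun j => Sum.inl (Fin.castLE hs j)) id i then (1 : F[X]) else 0)).submatrix
      id finSumFinEquiv.symm, ?_⟩
  rw [kernelGenerator, ← submatrix_mul _ _ _ _ _ Function.bijective_id, Matrix.mul_assoc,
    ← Matrix.mul_assoc (S.map (C (R := F)))ᵀ, ← transpose_mul, map_C_mul_map_C_eq_one h, transpose_one,
    Matrix.one_mul, shiftRows_mul_selection, submatrix_one_equiv]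

theorem mem_generatedCode {k n : ℕ} (G : Matrix (Fin k) (Fin n) F[X]) (u : Fin n → F[X]) :
    u ∈ generatedCode G ↔ ∃ w, w ᵥ* G = u := by
  simp [generatedCode, LinearMap.mem_range]

theorem mem_generatedCode_kernelGenerator {r s n m : ℕ} (hs : s ≤ r)
    {A : Matrix (Fin r) (Fin n) F} {B : Matrix (Fin s) (Fin n) F}
    {T : Matrix ((Fin r ⊕ Fin s) ⊕ Fin m) (Fin n) F}
    {S : Matrix (Fin n) ((Fin r ⊕ Fin s) ⊕ Fin m) F}
    (hT : ∀ i, T (Sum.inl i) = fromRows A B i) (h : T * S = 1) (h' : S * T = 1)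
    (u : Fin n → F[X]) :
    u ∈ generatedCode (kernelGenerator hs S) ↔ unitMemoryMatrix (padRows r B) A *ᵥ u = 0 := by
  have hTS := map_C_mul_map_C_eq_one h
  have hST := map_C_mul_map_C_eq_one h'
  rw [mem_generatedCode, unitMemoryMatrix_mulVec_eq_zero_iff hs A B T hT]
  have key : ∀ w : Fin s ⊕ Fin m → F[X], w ᵥ* (shiftRows F hs m * (S.map (C (R := F)))ᵀ) = u ↔
      w ᵥ* shiftRows F hs m = T.map (C (R := F)) *ᵥ u := by
    intro w
    rw [← vecMul_vecMul, vecMul_transpose]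
    constructor
    · rintro rfl
      rw [mulVec_mulVec, hTS, one_mulVec]
    · intro hw
      rw [hw, mulVec_mulVec, hST, one_mulVec]
  have hre : ∀ w : Fin (s + m) → F[X], w ᵥ* kernelGenerator hs S =
      (w ∘ finSumFinEquiv) ᵥ* (shiftRows F hs m * (S.map (C (R := F)))ᵀ) := by
    intro w
    ext c : 1
    simp only [vecMul, dotProduct, kernelGenerator, submatrix_apply, id]
    rw [← finSumFinEquiv.sum_comp]
    simp
  constructor
  · rintro ⟨w, hw⟩
    exact ⟨_, (key _).1 ((hre w).symm.trans hw)⟩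
  · rintro ⟨w, hw⟩
    refine ⟨w ∘ finSumFinEquiv.symm, ?_⟩
    rw [hre]
    convert (key w).2 hw using 2
    ext i : 1
    simp

theorem shiftRows_mul_inl {r s n m : ℕ} (hs : s ≤ r)
    (S : Matrix (Fin n) ((Fin r ⊕ Fin s) ⊕ Fin m) F) (j : Fin s) (c : Fin n) :
    (shiftRows F hs m * (S.map (C (R := F)))ᵀ) (Sum.inl j) c =
      C (S c (Sum.inl (Sum.inl (Fin.castLE hs j)))) - X * C (S c (Sum.inl (Sum.inr j))) := by
  simp [mul_apply, shiftRows, Pi.single_apply, sub_mul, Finset.sum_sub_distrib]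

theorem shiftRows_mul_inr {r s n m : ℕ} (hs : s ≤ r)
    (S : Matrix (Fin n) ((Fin r ⊕ Fin s) ⊕ Fin m) F) (l : Fin m) (c : Fin n) :
    (shiftRows F hs m * (S.map (C (R := F)))ᵀ) (Sum.inr l) c = C (S c (Sum.inr l)) := by
  simp [mul_apply, shiftRows, Pi.single_apply]

/-- The coefficient of `D` in this row is minus a column of `S`, and no column of `S` vanishes
because `T * S = 1`. -/
theorem rowDegree_kernelGenerator_inl {r s n m : ℕ} (hs : s ≤ r)
    {T : Matrix ((Fin r ⊕ Fin s) ⊕ Fin m) (Fin n) F}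
    {S : Matrix (Fin n) ((Fin r ⊕ Fin s) ⊕ Fin m) F} (h : T * S = 1) (j : Fin s) :
    rowDegree (kernelGenerator hs S) (finSumFinEquiv (Sum.inl j)) = 1 := by
  have hne : ∃ c, S c (Sum.inl (Sum.inr j)) ≠ 0 := by
    by_contra! hc
    have := congrFun (congrFun h (Sum.inl (Sum.inr j))) (Sum.inl (Sum.inr j))
    simp [mul_apply, hc] at this
  obtain ⟨c, hc⟩ := hne
  unfold rowDegree
  apply le_antisymm
  · refine Finset.sup_le fun c _ => ?_
    simp only [kernelGenerator, submatrix_apply, Equiv.symm_apply_apply, shiftRows_mul_inl, id]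
    compute_degree
  · refine le_trans ?_ (Finset.le_sup (Finset.mem_univ c))
    simp only [kernelGenerator, submatrix_apply, Equiv.symm_apply_apply, shiftRows_mul_inl, id]
    refine le_natDegree_of_ne_zero ?_
    simpa [coeff_C, coeff_X_mul] using hc

theorem rowDegree_kernelGenerator_inr {r s n m : ℕ} (hs : s ≤ r)
    (S : Matrix (Fin n) ((Fin r ⊕ Fin s) ⊕ Fin m) F) (l : Fin m) :
    rowDegree (kernelGenerator hs S) (finSumFinEquiv (Sum.inr l)) = 0 := by
  refine Nat.le_zero.1 (Finset.sup_le fun c _ => ?_)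
  simp only [kernelGenerator, submatrix_apply, Equiv.symm_apply_apply, shiftRows_mul_inr, id]
  simp

theorem constraintLength_kernelGenerator {r s n m : ℕ} (hs : s ≤ r)
    {T : Matrix ((Fin r ⊕ Fin s) ⊕ Fin m) (Fin n) F}
    {S : Matrix (Fin n) ((Fin r ⊕ Fin s) ⊕ Fin m) F} (h : T * S = 1) :
    constraintLength (kernelGenerator hs S) = s := by
  rw [constraintLength, ← finSumFinEquiv.sum_comp, Fintype.sum_sum_type]
  simp only [rowDegree_kernelGenerator_inl hs h, rowDegree_kernelGenerator_inr]
  simp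

theorem memory_kernelGenerator {r s n m : ℕ} (hs : s ≤ r) (h0 : 0 < s)
    {T : Matrix ((Fin r ⊕ Fin s) ⊕ Fin m) (Fin n) F}
    {S : Matrix (Fin n) ((Fin r ⊕ Fin s) ⊕ Fin m) F} (h : T * S = 1) :
    memory (kernelGenerator hs S) = 1 := by
  apply le_antisymm
  · refine Finset.sup_le fun i _ => ?_
    obtain ⟨x, rfl⟩ := finSumFinEquiv.surjective i
    rcases x with j | l
    · exact (rowDegree_kernelGenerator_inl hs h j).le
    · rw [rowDegree_kernelGenerator_inr]
      exact Nat.zero_le _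
  · rw [← rowDegree_kernelGenerator_inl hs h ⟨0, h0⟩]
    exact Finset.le_sup (Finset.mem_univ _)

theorem finrank_ker_mulVecLin {ι : Type*} [Fintype ι] {n : ℕ} {M : Matrix ι (Fin n) F}
    (hM : LinearIndependent F M.row) :
    Module.finrank F (LinearMap.ker M.mulVecLin) = n - Fintype.card ι := by
  have h := LinearMap.finrank_range_add_finrank_ker M.mulVecLin
  have h' : Module.finrank F (LinearMap.range M.mulVecLin) = Fintype.card ι :=
    hM.rank_matrix
  rw [h', Module.finrank_fin_fun] at h
  omega

/-- A basic matrix whose rows lie in the kernel of `B̃ + A D` has at most `dim ker [A; B]` constant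
rows. -/
theorem card_constant_rows_le {r s n k : ℕ} (hs : s ≤ r) {A : Matrix (Fin r) (Fin n) F}
    {B : Matrix (Fin s) (Fin n) F} (hAB : LinearIndependent F (fromRows A B).row)
    {G : Matrix (Fin k) (Fin n) F[X]} (hG : IsBasic G)
    (hGV : ∀ i, unitMemoryMatrix (padRows r B) A *ᵥ G i = 0) :
    (Finset.univ.filter fun i => rowDegree G i = 0).card ≤ n - (r + s) := by
  classical
  have hconst : ∀ i, rowDegree G i = 0 → ∀ j, G i j = C ((G i j).coeff 0) := fun i hi j =>
    eq_C_of_natDegree_eq_zero (Nat.le_zero.1 (hi ▸ Finset.le_sup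
      (f := fun j => (G i j).natDegree) (Finset.mem_univ j)))
  have hker : ∀ i : {i // rowDegree G i = 0},
      (fun j => (G i j).coeff 0) ∈ LinearMap.ker (fromRows A B).mulVecLin := by
    rintro ⟨i, hi⟩
    have h := hGV i
    have h0 : ∀ (a : Fin r) t, ((unitMemoryMatrix (padRows r B) A *ᵥ G i) a).coeff t = 0 := by
      intro a t
      rw [h]
      simp
    -- For a constant row, the coefficient of `D ^ 0` in the kernel equation gives the check by `B`,
    -- and that of `D ^ 1` gives the check by `A`.
    have hB : padRows r B *ᵥ (fun j => (G i j).coeff 0) = 0 := by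
      ext a
      have := h0 a 0
      rwa [unitMemoryMatrix_mulVec, Pi.add_apply, coeff_add, map_C_mulVec_coeff, Pi.smul_apply,
        smul_eq_mul, coeff_X_mul_zero, add_zero] at this
    have hA : A *ᵥ (fun j => (G i j).coeff 0) = 0 := by
      ext a
      have := h0 a 1
      rw [unitMemoryMatrix_mulVec, Pi.add_apply, coeff_add, map_C_mulVec_coeff, Pi.smul_apply,
        smul_eq_mul, coeff_X_mul, map_C_mulVec_coeff] at this
      have hz : (fun j => (G i j).coeff 1) = 0 := by
        ext j
        rw [hconst i hi j]
        simp
      rwa [hz, mulVec_zero, Pi.zero_apply, zero_add] at this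
    rw [LinearMap.mem_ker, mulVecLin_apply, fromRows_mulVec, hA,
      (padRows_mulVec_eq_zero_iff hs B _).1 hB]
    ext (_ | _) <;> rfl
  have hli : LinearIndependent F fun i : {i // rowDegree G i = 0} =>
      (⟨_, hker i⟩ : LinearMap.ker (fromRows A B).mulVecLin) := by
    rw [Fintype.linearIndependent_iff]
    intro g hg i₀
    obtain ⟨R, hR⟩ := hG
    have hg' : ∀ j, ∑ i : {i // rowDegree G i = 0}, g i * (G i j).coeff 0 = 0 := by
      intro j
      have := congrFun (congrArg Subtype.val hg) j
      simpa [Submodule.coe_sum] using this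
    -- A linear relation among the constant rows, extended by zero, is a relation `w G = 0`, and the
    -- right inverse of `G` forces `w = 0`.
    let w : Fin k → F[X] := fun i => if h : rowDegree G i = 0 then C (g ⟨i, h⟩) else 0
    have hw : w ᵥ* G = 0 := by
      ext1 j
      have hsum : (w ᵥ* G) j = ∑ i : {i // rowDegree G i = 0}, w i * G i j := by
        change ∑ i, w i * G i j = _
        rw [← Finset.sum_subtype (Finset.univ.filter fun i => rowDegree G i = 0) (by simp)
          (fun i => w i * G i j)]
        · rw [Finset.sum_filter]
          refine Finset.sum_congr rfl fun i _ => ?_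
          split_ifs with h
          · rfl
          · simp [w, h]
      rw [hsum, Pi.zero_apply, ← map_zero C, ← hg' j, map_sum]
      refine Finset.sum_congr rfl fun i _ => ?_
      rw [hconst i i.2 j, C_mul, coeff_C_zero]
      simp [w, i.2]
    have hw0 : w = 0 := by
      rw [← vecMul_one w, ← hR, ← vecMul_vecMul, hw, zero_vecMul]
    have := congrFun hw0 i₀
    simpa [w, i₀.2] using this
  have := hli.fintype_card_le_finrank
  rw [finrank_ker_mulVecLin hAB, Fintype.card_subtype] at this
  simpa using this

theorem mem_generatedCode_row {k n : ℕ} (G : Matrix (Fin k) (Fin n) F[X]) (i : Fin k) :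
    G i ∈ generatedCode G :=
  (mem_generatedCode G _).2 ⟨Pi.single i 1, by rw [single_one_vecMul]; rfl⟩

/-- The kernel of `B̃ + A D` has a reduced basic generator matrix of memory one. -/
theorem exists_isReducedBasic_of_kernel {r s n m : ℕ} (hs : s ≤ r) (h0 : 0 < s)
    (hn : r + s + m = n) {A : Matrix (Fin r) (Fin n) F} {B : Matrix (Fin s) (Fin n) F}
    (hAB : LinearIndependent F (fromRows A B).row) {V : Submodule F[X] (Fin n → F[X])}
    (hV : ∀ u, u ∈ V ↔ unitMemoryMatrix (padRows r B) A *ᵥ u = 0) :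
    ∃ G : Matrix (Fin (s + m)) (Fin n) F[X], IsReducedBasic G ∧ generatedCode G = V ∧
      constraintLength G = s ∧ memory G = 1 := by
  obtain ⟨T, S, hT, hTS, hST⟩ := exists_invertible_completion (m := m) (fromRows A B) hAB
    (by simpa using hn)
  have hgen : generatedCode (kernelGenerator hs S) = V := by
    ext u
    rw [hV, mem_generatedCode_kernelGenerator hs hT hTS hST]
  refine ⟨kernelGenerator hs S, ⟨isBasic_kernelGenerator hs hTS, fun G' hG' hcode => ?_⟩, hgen,
    constraintLength_kernelGenerator hs hTS, memory_kernelGenerator hs h0 hTS⟩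
  rw [constraintLength_kernelGenerator hs hTS]
  have hle := card_constant_rows_le hs hAB hG' fun i =>
    (hV _).1 (hgen ▸ hcode ▸ mem_generatedCode_row G' i)
  have hsplit := Finset.card_filter_add_card_filter_not (s := (Finset.univ : Finset (Fin (s + m))))
    (fun i => rowDegree G' i = 0)
  rw [Finset.card_univ, Fintype.card_fin] at hsplit
  -- Each nonconstant row contributes at least one to the constraint length, and at least `s` of the
  -- `s + m` rows are nonconstant.
  have hsum : (Finset.univ.filter fun i => ¬ rowDegree G' i = 0).card ≤ constraintLength G' := by
    rw [Finset.card_filter]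
    refine Finset.sum_le_sum fun i _ => ?_
    split_ifs <;> omega
  omega

end GeneratorMatrix

/-! ### The Hermitian dual as a kernel. -/

section Hermitian

variable {F : Type*} [Field F]

theorem hermitianForm_eq_sum_range (q : ℕ) {n : ℕ} (u v : Fin n → F[X]) {N : ℕ}
    (hN : ∀ j, (u j).natDegree < N) :
    hermitianForm q u v =
      ∑ j, ∑ t ∈ Finset.range N, (u j).coeff t * (v j).coeff t ^ q := by
  unfold hermitianForm
  exact Finset.sum_congr rfl fun j _ => sum_over_range' _ (fun t => by simp) _ (hN j)

theorem exists_natDegree_lt {n : ℕ} (u : Fin n → F[X]) : ∃ N, ∀ j, (u j).natDegree < N :=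
  ⟨Finset.univ.sup (fun j => (u j).natDegree) + 1, fun j =>
    Nat.lt_succ_of_le (Finset.le_sup (f := fun j => (u j).natDegree) (Finset.mem_univ j))⟩

theorem hermitianForm_add_right {q : ℕ} {σ : F →+* F} (hσ : ∀ x, σ x = x ^ q) {n : ℕ}
    (u v v' : Fin n → F[X]) :
    hermitianForm q u (v + v') = hermitianForm q u v + hermitianForm q u v' := by
  obtain ⟨N, hN⟩ := exists_natDegree_lt u
  simp only [hermitianForm_eq_sum_range q u _ hN, ← Finset.sum_add_distrib, ← hσ]
  simp [mul_add]

theorem hermitianForm_C_smul_right {q : ℕ} (c : F) {n : ℕ} (u v : Fin n → F[X]) :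
    hermitianForm q u (C c • v) = c ^ q * hermitianForm q u v := by
  obtain ⟨N, hN⟩ := exists_natDegree_lt u
  simp only [hermitianForm_eq_sum_range q u _ hN, Finset.mul_sum]
  refine Finset.sum_congr rfl fun j _ => Finset.sum_congr rfl fun t _ => ?_
  simp [mul_pow]
  ring

theorem hermitianForm_zero_right {q : ℕ} (hq : q ≠ 0) {n : ℕ} (u : Fin n → F[X]) :
    hermitianForm q u 0 = 0 := by
  simp [hermitianForm, hq, Polynomial.sum]

/-- The shifted row has coefficient `A a` at `D ^ t` and `P a` at `D ^ (t + 1)`, so the form is the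
`a`-th entry of `A^σ u_t + P^σ u_{t+1}`. This exchanges the roles of `A` and `P`. -/
theorem hermitianForm_X_pow_smul_row {q : ℕ} (hq : q ≠ 0) {σ : F →+* F} (hσ : ∀ x, σ x = x ^ q)
    {r n : ℕ} (A P : Matrix (Fin r) (Fin n) F) (u : Fin n → F[X]) (t : ℕ) (a : Fin r) :
    hermitianForm q u ((X ^ t : F[X]) • unitMemoryMatrix A P a) =
      ((unitMemoryMatrix (P.map σ) (A.map σ) *ᵥ u) a).coeff (t + 1) := by
  obtain ⟨N, hN⟩ := exists_natDegree_lt u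
  have hM : ∀ j, (u j).natDegree < N + t + 2 := fun j => (hN j).trans_le (by omega)
  have h1 : ∀ j l, (((X ^ t : F[X]) • unitMemoryMatrix A P a) j).coeff l ^ q =
      (if l = t then σ (A a j) else 0) + (if l = t + 1 then σ (P a j) else 0) := by
    intro j l
    have : ((X ^ t : F[X]) • unitMemoryMatrix A P a) j =
        C (A a j) * X ^ t + C (P a j) * X ^ (t + 1) := by
      simp [unitMemoryMatrix]
      ring
    rw [this, coeff_add, coeff_C_mul_X_pow, coeff_C_mul_X_pow, hσ, hσ]
    by_cases h : l = t
    · subst h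
      simp
    · by_cases h' : l = t + 1
      · subst h'
        simp
      · simp [h, h', hq]
  rw [hermitianForm_eq_sum_range q u _ hM]
  simp only [h1, mul_add, mul_ite, mul_zero, Finset.sum_add_distrib, Finset.sum_ite_eq',
    Finset.mem_range, show t < N + t + 2 by omega, show t + 1 < N + t + 2 by omega, if_true]
  simp only [unitMemoryMatrix, mulVec, dotProduct, finsetSum_coeff, ← Finset.sum_add_distrib]
  refine Finset.sum_congr rfl fun j _ => ?_
  simp [add_mul, mul_assoc, coeff_X_mul]
  ring

/-- The Hermitian dual of the code generated by `A + P D` is the kernel of the conjugate of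
`P + A D`. -/
theorem mem_hermitianDual_unitMemoryMatrix {q : ℕ} (hq : q ≠ 0) {σ : F →+* F}
    (hσ : ∀ x, σ x = x ^ q) {r n : ℕ} (A P : Matrix (Fin r) (Fin n) F) (u : Fin n → F[X]) :
    u ∈ hermitianDual q (generatedCode (unitMemoryMatrix A P)) ↔
      unitMemoryMatrix (P.map σ) (A.map σ) *ᵥ u = 0 := by
  constructor
  · intro h
    ext a t
    -- Pairing with shifted rows sees only coefficients of index at least one. Multiplying `u` by
    -- `X` first brings in the coefficient of index zero.
    have := h X ((X ^ t : F[X]) • unitMemoryMatrix A P a)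
      (Submodule.smul_mem _ _ ⟨Pi.single a 1, by simp [Matrix.row]⟩)
    rw [hermitianForm_X_pow_smul_row hq hσ, mulVec_smul, Pi.smul_apply, smul_eq_mul,
      coeff_X_mul] at this
    simpa using this
  · rintro h f _ ⟨w, rfl⟩
    have hrow : ∀ (g : F[X]) (a : Fin r),
        hermitianForm q (f • u) (g • unitMemoryMatrix A P a) = 0 := by
      intro g a
      induction g using Polynomial.induction_on' with
      | add g g' hg hg' => rw [add_smul, hermitianForm_add_right hσ, hg, hg', add_zero]
      | monomial t c =>
        rw [← C_mul_X_pow_eq_monomial, mul_smul, hermitianForm_C_smul_right,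
          hermitianForm_X_pow_smul_row hq hσ, mulVec_smul, h]
        simp
    have hw : (unitMemoryMatrix A P).vecMulLinear w = ∑ a, w a • unitMemoryMatrix A P a := by
      ext1 j
      simp [vecMul, dotProduct]
    rw [hw]
    refine Finset.sum_induction _ (fun v => hermitianForm q (f • u) v = 0) (fun v v' hv hv' => ?_)
      (hermitianForm_zero_right hq _) (fun a _ => hrow _ _)
    rw [hermitianForm_add_right hσ, hv, hv', add_zero]

end Hermitian

/-! ### Free distance of the kernel code. -/

section FreeDistance

variable {F : Type*} [Field F]

theorem coeff_of_unitMemoryMatrix_mulVec_eq_zero {r n : ℕ} {P A : Matrix (Fin r) (Fin n) F}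
    {u : Fin n → F[X]} (hu : unitMemoryMatrix P A *ᵥ u = 0) :
    P *ᵥ (fun j => (u j).coeff 0) = 0 ∧
      ∀ t, P *ᵥ (fun j => (u j).coeff (t + 1)) + A *ᵥ (fun j => (u j).coeff t) = 0 := by
  have h : ∀ (a : Fin r) t, ((unitMemoryMatrix P A *ᵥ u) a).coeff t = 0 := fun a t => by
    rw [hu]
    simp
  constructor
  · ext a
    have := h a 0
    rwa [unitMemoryMatrix_mulVec, Pi.add_apply, coeff_add, map_C_mulVec_coeff, Pi.smul_apply,
      smul_eq_mul, coeff_X_mul_zero, add_zero] at this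
  · intro t
    ext a
    have := h a (t + 1)
    rwa [unitMemoryMatrix_mulVec, Pi.add_apply, coeff_add, map_C_mulVec_coeff, Pi.smul_apply,
      smul_eq_mul, coeff_X_mul, map_C_mulVec_coeff] at this

variable [DecidableEq F]

theorem sum_hammingNorm_coeff_le_weight {n : ℕ} (u : Fin n → F[X]) (I : Finset ℕ) :
    ∑ t ∈ I, hammingNorm (fun j => (u j).coeff t) ≤ weight u := by
  have : ∀ t, hammingNorm (fun j => (u j).coeff t) =
      ∑ j, if (u j).coeff t ≠ 0 then 1 else 0 := fun t => by
    rw [hammingNorm, Finset.card_filter]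
  simp only [this]
  rw [Finset.sum_comm]
  refine Finset.sum_le_sum fun j _ => ?_
  rw [← Finset.card_filter]
  refine Finset.card_le_card fun t ht => ?_
  rw [Finset.mem_filter] at ht
  exact mem_support_iff.2 ht.2

theorem weight_C_le {n : ℕ} (c : Fin n → F) :
    weight (fun j => C (c j)) ≤ hammingNorm c := by
  rw [weight, hammingNorm, Finset.card_filter]
  refine Finset.sum_le_sum fun j _ => ?_
  split_ifs with h
  · exact (Finset.card_le_card (support_C_subset _)).trans (by simp)
  · rw [not_not] at h
    simp [h]

/-- The kernel recursion degenerates at both ends: with nothing before the first nonzero coefficient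
vector only the check by `B` remains, and with nothing after the last only the check by `A`.
Distinct ends contribute `d₀ + d₁`; a single one satisfies both checks. -/
theorem hasFreeDistance_of_kernel {r s n d d₀ d₁ : ℕ} (hs : s ≤ r)
    {A : Matrix (Fin r) (Fin n) F} {B : Matrix (Fin s) (Fin n) F}
    {V : Submodule F[X] (Fin n → F[X])}
    (hV : ∀ u, u ∈ V ↔ unitMemoryMatrix (padRows r B) A *ᵥ u = 0)
    (hB : ∀ c ≠ 0, B *ᵥ c = 0 → d₀ ≤ hammingNorm c)
    (hA : ∀ c ≠ 0, A *ᵥ c = 0 → d₁ ≤ hammingNorm c)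
    (hAB : ∀ c ≠ 0, A *ᵥ c = 0 → B *ᵥ c = 0 → d ≤ hammingNorm c) (hd : d ≤ d₀ + d₁)
    (hex : ∃ c ≠ 0, A *ᵥ c = 0 ∧ B *ᵥ c = 0 ∧ hammingNorm c ≤ d) :
    HasFreeDistance V d := by
  have hlow : ∀ u ∈ V, u ≠ 0 → d ≤ weight u := by
    intro u hu hu0
    obtain ⟨h0, h1⟩ := coeff_of_unitMemoryMatrix_mulVec_eq_zero ((hV u).1 hu)
    set v : ℕ → Fin n → F := fun t j => (u j).coeff t with hv
    let I : Finset ℕ := Finset.univ.biUnion fun j => (u j).support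
    have hI : ∀ t, t ∈ I ↔ v t ≠ 0 := by
      intro t
      simp [I, hv, funext_iff]
    have hne : I.Nonempty := by
      obtain ⟨j, hj⟩ := Function.ne_iff.1 hu0
      obtain ⟨t, ht⟩ := nonempty_support_iff.2 hj
      exact ⟨t, Finset.mem_biUnion.2 ⟨j, Finset.mem_univ j, ht⟩⟩
    have hfirst : B *ᵥ v (I.min' hne) = 0 := by
      rw [← padRows_mulVec_eq_zero_iff hs]
      rcases ht : I.min' hne with _ | t
      · exact h0
      · have hz : v t = 0 := by
          by_contra hz
          have := I.min'_le t ((hI t).2 hz)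
          omega
        have := h1 t
        change _ + A *ᵥ v t = 0 at this
        rwa [hz, mulVec_zero, add_zero] at this
    have hlast : A *ᵥ v (I.max' hne) = 0 := by
      have hz : v (I.max' hne + 1) = 0 := by
        by_contra hz
        have := I.le_max' _ ((hI _).2 hz)
        omega
      have := h1 (I.max' hne)
      change padRows r B *ᵥ v (I.max' hne + 1) + _ = 0 at this
      rwa [hz, mulVec_zero, zero_add] at this
    have hmin := (hI _).1 (I.min'_mem hne)
    have hmax := (hI _).1 (I.max'_mem hne)
    by_cases heq : I.min' hne = I.max' hne
    · have := sum_hammingNorm_coeff_le_weight u {I.min' hne}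
      rw [Finset.sum_singleton] at this
      exact (hAB _ hmin (heq ▸ hlast) hfirst).trans this
    · have := sum_hammingNorm_coeff_le_weight u {I.min' hne, I.max' hne}
      rw [Finset.sum_pair heq] at this
      exact hd.trans ((Nat.add_le_add (hB _ hmin hfirst) (hA _ hmax hlast)).trans this)
  refine ⟨?_, ?_⟩
  · obtain ⟨c, hc0, hcA, hcB, hcd⟩ := hex
    have hmem : (fun j => C (c j)) ∈ V := by
      have hmap : ∀ M : Matrix (Fin r) (Fin n) F, M *ᵥ c = 0 →
          M.map (C (R := F)) *ᵥ (fun j => C (c j)) = 0 := by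
        intro M hM
        ext1 a
        have := (RingHom.map_mulVec (C (R := F)) M c a).symm
        rw [hM, Pi.zero_apply, map_zero] at this
        exact this
      rw [hV, unitMemoryMatrix_mulVec, hmap _ ((padRows_mulVec_eq_zero_iff hs B c).2 hcB),
        hmap _ hcA, smul_zero, add_zero]
    have hne : (fun j => C (c j)) ≠ 0 := by
      intro h
      exact hc0 (funext fun j => C_eq_zero.1 (congrFun h j))
    exact ⟨_, hmem, hne, le_antisymm ((weight_C_le c).trans hcd) (hlow _ hmem hne)⟩
  · rintro _ ⟨u, hu, hu0, rfl⟩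
    exact hlow u hu hu0

end FreeDistance

/-! ### Parity-check matrices and their conjugates. -/

section ParityCheck

variable {F : Type*} [Field F]

theorem linearIndependent_row_of_finrank {ι : Type*} [Fintype ι] {n : ℕ} {H : Matrix ι (Fin n) F}
    {B : Submodule F (Fin n → F)} (hH : ∀ c, c ∈ B ↔ H *ᵥ c = 0)
    (hB : Module.finrank F B + Fintype.card ι = n) : LinearIndependent F H.row := by
  have hker : LinearMap.ker H.mulVecLin = B := by
    ext c
    rw [LinearMap.mem_ker, mulVecLin_apply, hH]
  have h := LinearMap.finrank_range_add_finrank_ker H.mulVecLin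
  rw [hker, Module.finrank_fin_fun] at h
  have hr : H.rank = Fintype.card ι := by
    rw [Matrix.rank]
    omega
  rw [linearIndependent_iff_card_eq_finrank_span, ← hr, Matrix.rank_eq_finrank_span_row]
  rfl

theorem exists_isParityCheck {n r : ℕ} {B : Submodule F (Fin n → F)}
    (hB : Module.finrank F B + r = n) : ∃ H : Matrix (Fin r) (Fin n) F, IsParityCheck H B := by
  have hq : Module.finrank F ((Fin n → F) ⧸ B) = r := by
    have := B.finrank_quotient_add_finrank
    rw [Module.finrank_fin_fun] at this
    omega
  let e : ((Fin n → F) ⧸ B) ≃ₗ[F] (Fin r → F) :=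
    LinearEquiv.ofFinrankEq _ _ (by rw [hq, Module.finrank_fin_fun])
  have hker : ∀ c, c ∈ B ↔ LinearMap.toMatrix' (e.toLinearMap ∘ₗ B.mkQ) *ᵥ c = 0 := by
    intro c
    rw [← toLin'_apply, toLin'_toMatrix']
    simp
  exact ⟨_, linearIndependent_row_of_finrank hker (by simpa using hB), hker⟩

/-- As `σ` is an involution, applying it entrywise to one equation yields the other. -/
theorem map_mulVec_eq_zero_iff {σ : F →+* F} (hσ : ∀ x, σ (σ x) = x) {ι : Type*} {n : ℕ}
    (H : Matrix ι (Fin n) F) (c : Fin n → F) : H.map σ *ᵥ c = 0 ↔ H *ᵥ (σ ∘ c) = 0 := by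
  have h : ∀ a, σ ((H *ᵥ (σ ∘ c)) a) = (H.map σ *ᵥ c) a := fun a => by
    rw [RingHom.map_mulVec]
    congr 2
    ext j
    exact hσ _
  constructor
  · intro h0
    ext a
    apply σ.injective
    rw [h, h0]
    simp
  · intro h0
    ext a
    rw [← h, h0]
    simp

theorem linearIndependent_row_map {σ : F →+* F} (hσ : ∀ x, σ (σ x) = x) {ι : Type*} [Fintype ι]
    {n : ℕ} {H : Matrix ι (Fin n) F} (hH : LinearIndependent F H.row) :
    LinearIndependent F (H.map σ).row := by
  rw [Fintype.linearIndependent_iff] at hH ⊢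
  intro g hg i
  have := hH (σ ∘ g) (by
    ext j
    have := congrArg σ (congrFun hg j)
    simpa [hσ, map_sum] using this) i
  simpa using this

end ParityCheck

/-! ### Dimension and weights of negacyclic codes. -/

section Negacyclic

variable {F : Type*} [Field F]

theorem vecPoly_apply {n : ℕ} (c : Fin n → F) : vecPoly c = ∑ t : Fin n, monomial (t : ℕ) (c t) := by
  simp [vecPoly]

theorem aeval_vecPoly {K : Type*} [Field K] [Algebra F K] {n : ℕ} (c : Fin n → F) (y : K) :
    aeval y (vecPoly c) = ∑ t : Fin n, algebraMap F K (c t) * y ^ (t : ℕ) := by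
  simp [vecPoly_apply, map_sum, aeval_monomial]

theorem vecPoly_coeff {n : ℕ} {p : F[X]} (hp : p.natDegree < n) :
    vecPoly (fun t : Fin n => p.coeff t) = p := by
  conv_rhs => rw [p.as_sum_range' n hp]
  rw [vecPoly_apply, Finset.sum_range]

theorem mem_negacyclicCode {n : ℕ} {g : F[X]} (hg : g ∣ X ^ n + 1) (c : Fin n → F) :
    c ∈ negacyclicCode n g ↔ g ∣ vecPoly c := by
  have hmap : Ideal.span {Ideal.Quotient.mk (Ideal.span {(X ^ n + 1 : F[X])}) g} =
      (Ideal.span {g}).map (Ideal.Quotient.mk (Ideal.span {(X ^ n + 1 : F[X])})) := by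
    rw [Ideal.map_span, Set.image_singleton]
  rw [negacyclicCode, Submodule.mem_comap, Submodule.restrictScalars_mem, hmap,
    Ideal.comap_map_of_surjective _ Ideal.Quotient.mk_surjective,
    ← RingHom.ker_eq_comap_bot, Ideal.mk_ker, ← Ideal.mem_span_singleton, sup_eq_left.2]
  exact Ideal.span_singleton_le_span_singleton.2 hg

/-- The code is the kernel of the map from `F ^ n` to `F[x] / (g)`, which is onto by division with
remainder. -/
theorem finrank_negacyclicCode {n : ℕ} (hn : n ≠ 0) {g : F[X]} (hg : g ∣ X ^ n + 1) :
    Module.finrank F (negacyclicCode n g) + g.natDegree = n := by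
  have hX : (X ^ n + 1 : F[X]) ≠ 0 := (monic_X_pow_add_C 1 hn).ne_zero
  have hg0 : g ≠ 0 := ne_zero_of_dvd_ne_zero hX hg
  have hdeg : g.natDegree ≤ n := (natDegree_le_of_dvd hg hX).trans (natDegree_X_pow_add_C (r := 1)).le
  let f : (Fin n → F) →ₗ[F] F[X] ⧸ Ideal.span {g} :=
    (Ideal.Quotient.mkₐ F (Ideal.span {g})).toLinearMap ∘ₗ vecPoly
  have hker : LinearMap.ker f = negacyclicCode n g := by
    ext c
    rw [mem_negacyclicCode hg, LinearMap.mem_ker, ← Ideal.mem_span_singleton,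
      ← Ideal.Quotient.eq_zero_iff_mem]
    rfl
  have hsurj : Function.Surjective f := by
    intro x
    obtain ⟨p, rfl⟩ := Ideal.Quotient.mk_surjective x
    -- A constant `g` is separated because the strict bound on the degree of the remainder fails
    -- there; the quotient is then zero.
    by_cases hu : g.natDegree = 0
    · refine ⟨0, ?_⟩
      rw [map_zero, eq_comm, Ideal.Quotient.eq_zero_iff_mem, Ideal.mem_span_singleton]
      exact (isUnit_iff_degree_eq_zero.2 ((degree_eq_iff_natDegree_eq hg0).2 hu)).dvd
    · have hlt : (p % g).natDegree < n := (natDegree_mod_lt p hu).trans_le hdeg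
      refine ⟨fun t => (p % g).coeff t, ?_⟩
      change Ideal.Quotient.mk _ (vecPoly _) = _
      rw [vecPoly_coeff hlt, Ideal.Quotient.eq, Ideal.mem_span_singleton]
      exact ⟨-(p / g), by linear_combination EuclideanDomain.mod_add_div p g⟩
  have h := LinearMap.finrank_range_add_finrank_ker f
  rw [hker, LinearMap.range_eq_top.2 hsurj, finrank_top, finrank_quotient_span_eq_natDegree,
    Module.finrank_fin_fun] at h
  omega

/-- The generator itself is a codeword with at most `deg g + 1` nonzero coefficients. -/
theorem exists_mem_hammingNorm_le [DecidableEq F] {n : ℕ} {g : F[X]} (hg0 : g ≠ 0)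
    (hgn : g.natDegree < n) (hg : g ∣ X ^ n + 1) :
    ∃ c ∈ negacyclicCode n g, c ≠ 0 ∧ hammingNorm c ≤ g.natDegree + 1 := by
  refine ⟨fun t => g.coeff t, ?_, ?_, ?_⟩
  · rw [mem_negacyclicCode hg, vecPoly_coeff hgn]
  · intro h
    have := congrFun h ⟨g.natDegree, hgn⟩
    exact hg0 (leadingCoeff_eq_zero.1 this)
  · rw [hammingNorm, ← Finset.card_range (g.natDegree + 1)]
    refine Finset.card_le_card_of_injOn (fun t : Fin n => (t : ℕ)) (fun t ht => ?_)
      Fin.val_injective.injOn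
    have : g.coeff t ≠ 0 := by simpa using ht
    simpa [Nat.lt_succ_iff] using le_natDegree_of_ne_zero this

/-- A vector whose first `N` power moments vanish has weight larger than `N`. -/
theorem lt_hammingNorm_of_sum_mul_pow_eq_zero {K : Type*} [Field K] [DecidableEq K] {ι : Type*}
    [Fintype ι] {x c : ι → K} (hx : Function.Injective x) (hc : c ≠ 0) {N : ℕ}
    (h : ∀ s < N, ∑ t, c t * x t ^ s = 0) : N < hammingNorm c := by
  classical
  by_contra! hle
  obtain ⟨t₀, ht₀⟩ := Function.ne_iff.1 hc
  let S := Finset.univ.filter fun t => c t ≠ 0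
  have hmem : t₀ ∈ S := by simpa [S] using ht₀
  -- In place of a Vandermonde determinant: `p` vanishes at every support point except `t₀`. If the
  -- weight were at most `N`, its degree would be below `N`, so the moments give `∑ c_t p(x_t) = 0`,
  -- although only the nonzero term at `t₀` survives.
  let p : K[X] := ∏ t ∈ S.erase t₀, (X - C (x t))
  have hdeg : p.natDegree < N := by
    have : p.natDegree = (S.erase t₀).card := natDegree_finsetProd_X_sub_C_eq_card _ _
    rw [this]
    exact (Finset.card_erase_lt_of_mem hmem).trans_le hle
  have hsum : ∑ t, c t * p.eval (x t) = 0 := by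
    simp only [eval_eq_sum_range' hdeg, Finset.mul_sum]
    rw [Finset.sum_comm]
    refine Finset.sum_eq_zero fun s hs => ?_
    rw [← mul_zero (p.coeff s), ← h s (Finset.mem_range.1 hs), Finset.mul_sum]
    exact Finset.sum_congr rfl fun t _ => by ring
  rw [Finset.sum_eq_single t₀ _ (by simp)] at hsum
  · refine (mul_ne_zero ht₀ ?_) hsum
    rw [eval_prod, Finset.prod_ne_zero_iff]
    intro t ht
    rw [eval_sub, eval_X, eval_C]
    exact sub_ne_zero.2 fun h => (Finset.mem_erase.1 ht).1 (hx h).symm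
  · intro t _ htt
    by_cases hct : c t = 0
    · rw [hct, zero_mul]
    · rw [eval_prod, Finset.prod_eq_zero (i := t), mul_zero]
      · exact Finset.mem_erase.2 ⟨htt, by simpa [S] using hct⟩
      · simp

end Negacyclic

/-! ### Minimal polynomials of powers of `β` and the BCH bound. -/

section BCH

variable {F : Type*} [Field F] {K : Type*} [Field K] [Algebra F K]

/-- `X ^ |F| - X` already splits over `F`, so it has no further roots in `K`. -/
theorem mem_range_algebraMap_of_pow_card_eq [Fintype F] {x : K} (hx : x ^ Fintype.card F = x) :
    x ∈ (algebraMap F K).range := by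
  have hq : 1 < Fintype.card F := Fintype.one_lt_card
  have hprod : (X ^ Fintype.card F - X : F[X]) = ∏ a : F, (X - C a) := by
    have := prod_multiset_X_sub_C_of_monic_of_roots_card_eq (p := (X ^ Fintype.card F - X : F[X]))
      (monic_X_pow_sub (by rw [degree_X]; exact_mod_cast hq))
      (by rw [FiniteField.roots_X_pow_card_sub_X, FiniteField.X_pow_card_sub_X_natDegree_eq _ hq]
          rfl)
    rw [FiniteField.roots_X_pow_card_sub_X] at this
    exact this.symm
  have h := congrArg (aeval x) hprod
  simp only [map_sub, map_pow, aeval_X, hx, sub_self, map_prod, aeval_C] at h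
  obtain ⟨a, -, ha⟩ := Finset.prod_eq_zero_iff.1 h.symm
  exact ⟨a, (sub_eq_zero.1 ha).symm⟩

theorem aeval_inv_eq_zero [Fintype F] {y : K} (hy : y ^ Fintype.card F = y⁻¹) {p : F[X]}
    (hp : aeval y p = 0) : aeval y⁻¹ p = 0 := by
  have h := aeval_algHom_apply (FiniteField.frobeniusAlgHom F K) y p
  rw [hp, map_zero] at h
  rw [← hy]
  exact h

/-- Frobenius swaps `y` and `y⁻¹`, so their sum is fixed and lies in `F`; their product is one. -/
theorem exists_aeval_quadratic [Fintype F] {y : K} (hy0 : y ≠ 0) (hy : y ^ Fintype.card F = y⁻¹) :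
    ∃ a : F, ∀ z : K, aeval z (X ^ 2 - C a * X + 1 : F[X]) = (z - y) * (z - y⁻¹) := by
  have hfix : (y + y⁻¹) ^ Fintype.card F = y + y⁻¹ := by
    have := map_add (FiniteField.frobeniusAlgHom F K) y y⁻¹
    simp only [FiniteField.coe_frobeniusAlgHom] at this
    rw [this, inv_pow, hy, inv_inv, add_comm]
  obtain ⟨a, ha⟩ := mem_range_algebraMap_of_pow_card_eq hfix
  refine ⟨a, fun z => ?_⟩
  simp only [map_add, map_sub, map_pow, map_mul, aeval_X, aeval_C, ha, map_one]
  have : y * y⁻¹ = 1 := mul_inv_cancel₀ hy0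
  linear_combination -this

variable {n : ℕ} {β : K}

theorem pow_eq_inv_of_add_one_eq {N : ℕ} (hβ : IsPrimitiveRoot β (2 * n)) (hN : N + 1 = 2 * n)
    (j : ℕ) : (β ^ j) ^ N = (β ^ j)⁻¹ := by
  rw [← mul_eq_one_iff_eq_inv₀ (pow_ne_zero _ (hβ.ne_zero (by omega))), ← pow_succ, hN, ← pow_mul,
    mul_comm, pow_mul, hβ.pow_eq_one, one_pow]

theorem pow_self_eq_neg_one (hβ : IsPrimitiveRoot β (2 * n)) (hn : 0 < n) : β ^ n = -1 := by
  have h : (β ^ n) ^ 2 = 1 := by rw [← pow_mul, mul_comm, hβ.pow_eq_one]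
  exact (mul_self_eq_one_iff.1 (by rw [← sq, h])).resolve_left (hβ.pow_ne_one_of_pos_of_lt hn.ne' (by omega))

theorem isIntegral_pow [Fintype F] (hβ : IsPrimitiveRoot β (2 * n))
    (hn : Fintype.card F + 1 = 2 * n) (j : ℕ) : IsIntegral F (β ^ j) := by
  obtain ⟨a, ha⟩ := exists_aeval_quadratic (pow_ne_zero j (hβ.ne_zero (by omega)))
    (pow_eq_inv_of_add_one_eq hβ hn j)
  refine ⟨X ^ 2 - C a * X + 1, by monicity!, ?_⟩
  rw [← aeval_def, ha, sub_self, zero_mul]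

theorem natDegree_minpoly_pow [Fintype F] (hβ : IsPrimitiveRoot β (2 * n))
    (hn : Fintype.card F + 1 = 2 * n) {j : ℕ} (hj0 : 0 < j) (hj : j < n) :
    (minpoly F (β ^ j)).natDegree = 2 := by
  have hy := pow_eq_inv_of_add_one_eq hβ hn j
  obtain ⟨a, ha⟩ := exists_aeval_quadratic (pow_ne_zero j (hβ.ne_zero (by omega))) hy
  have hdeg : (X ^ 2 - C a * X + 1 : F[X]).natDegree = 2 := by compute_degree!
  apply le_antisymm
  · rw [← hdeg]
    refine natDegree_le_of_dvd (minpoly.dvd _ _ (by rw [ha, sub_self, zero_mul])) ?_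
    intro h
    simp [h] at hdeg
  -- If `β ^ j` were in `F`, Frobenius would fix it, giving `β ^ (2j) = 1` with `0 < 2j < 2n`.
  · rw [minpoly.two_le_natDegree_iff (isIntegral_pow hβ hn j)]
    rintro ⟨x, hx⟩
    rw [← hx, ← map_pow, FiniteField.pow_card, hx, ← mul_eq_one_iff_eq_inv₀
      (pow_ne_zero _ (hβ.ne_zero (by omega))), ← pow_add] at hy
    exact hβ.pow_ne_one_of_pos_of_lt (by omega) (by omega) hy

/-- Equal minimal polynomials force `β ^ l = β ^ (±j)`, and the minus sign is excluded by `0 < l + j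
< 2n`. -/
theorem minpoly_pow_injOn [Fintype F] (hβ : IsPrimitiveRoot β (2 * n))
    (hn : Fintype.card F + 1 = 2 * n) {j l : ℕ} (hj0 : 0 < j) (hj : j < n) (hl : l < n)
    (h : minpoly F (β ^ j) = minpoly F (β ^ l)) : j = l := by
  obtain ⟨a, ha⟩ := exists_aeval_quadratic (pow_ne_zero j (hβ.ne_zero (by omega)))
    (pow_eq_inv_of_add_one_eq hβ hn j)
  have hdvd : minpoly F (β ^ l) ∣ X ^ 2 - C a * X + 1 :=
    h ▸ minpoly.dvd _ _ (by rw [ha, sub_self, zero_mul])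
  have h0 := minpoly.dvd_iff.1 hdvd
  rw [ha, mul_eq_zero, sub_eq_zero, sub_eq_zero, ← mul_eq_one_iff_eq_inv₀
    (pow_ne_zero _ (hβ.ne_zero (by omega))), ← pow_add] at h0
  rcases h0 with h0 | h0
  · exact (hβ.pow_inj (by omega) (by omega) h0).symm
  · exact absurd h0 (hβ.pow_ne_one_of_pos_of_lt (by omega) (by omega))

/-- The factors are distinct monic irreducibles, hence pairwise coprime. -/
theorem bchGenerator_dvd_iff {b δ : ℕ} (hint : ∀ j, IsIntegral F (β ^ j)) (p : F[X]) :
    bchGenerator F β b δ ∣ p ↔ ∀ t < δ - 1, aeval (β ^ (b + 2 * t)) p = 0 := by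
  obtain ⟨S, hS, hprod⟩ : ∃ S : Finset F[X],
      (∀ P, P ∈ S ↔ ∃ t < δ - 1, minpoly F (β ^ (b + 2 * t)) = P) ∧
        bchGenerator F β b δ = ∏ P ∈ S, P := ⟨_, fun P => by simp, rfl⟩
  rw [hprod]
  constructor
  · intro h t ht
    exact minpoly.dvd_iff.1 ((Finset.dvd_prod_of_mem (fun P => P) ((hS _).2 ⟨t, ht, rfl⟩)).trans h)
  · intro h
    refine Finset.prod_dvd_of_coprime (fun P hP Q hQ hPQ => ?_) fun P hP => ?_
    · obtain ⟨t, -, rfl⟩ := (hS P).1 hP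
      obtain ⟨t', -, rfl⟩ := (hS Q).1 hQ
      refine ((minpoly.irreducible (hint _)).coprime_iff_not_dvd).2 fun hdvd => hPQ ?_
      exact eq_of_monic_of_associated (minpoly.monic (hint _)) (minpoly.monic (hint _))
        ((minpoly.irreducible (hint _)).associated_of_dvd (minpoly.irreducible (hint _)) hdvd)
    · obtain ⟨t, ht, rfl⟩ := (hS P).1 hP
      exact minpoly.dvd _ _ (h t ht)

theorem bchGenerator_dvd_X_pow_add_one {b δ : ℕ} (hint : ∀ j, IsIntegral F (β ^ j))
    (hβ : IsPrimitiveRoot β (2 * n)) (hn : 0 < n) (hb : Odd b) :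
    bchGenerator F β b δ ∣ X ^ n + 1 := by
  rw [bchGenerator_dvd_iff hint]
  intro t _
  have hodd : Odd (b + 2 * t) := hb.add_even (even_two_mul t)
  rw [map_add, map_pow, aeval_X, map_one, ← pow_mul, mul_comm, pow_mul,
    pow_self_eq_neg_one hβ hn, hodd.neg_one_pow, neg_add_cancel]

theorem natDegree_bchGenerator [Fintype F] (hβ : IsPrimitiveRoot β (2 * n))
    (hn : Fintype.card F + 1 = 2 * n) {b δ : ℕ} (hb : 0 < b) (hbδ : ∀ t < δ - 1, b + 2 * t < n) :
    (bchGenerator F β b δ).natDegree = 2 * (δ - 1) := by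
  classical
  have hint := isIntegral_pow hβ hn
  rw [bchGenerator, Finset.prod_image, natDegree_prod_of_monic _ _ fun t _ => minpoly.monic (hint _),
    Finset.sum_congr rfl fun t ht => natDegree_minpoly_pow hβ hn (by omega)
      (hbδ t (Finset.mem_range.1 ht))]
  · simp [mul_comm]
  · intro t ht t' ht' h
    have := minpoly_pow_injOn hβ hn (by omega) (hbδ t (by simpa using ht))
      (hbδ t' (by simpa using ht')) h
    omega

theorem mem_negacyclicBCH {b δ : ℕ} (hint : ∀ j, IsIntegral F (β ^ j))
    (hβ : IsPrimitiveRoot β (2 * n)) (hn : 0 < n) (hb : Odd b) (c : Fin n → F) :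
    c ∈ negacyclicBCH F n β b δ ↔ ∀ t < δ - 1, aeval (β ^ (b + 2 * t)) (vecPoly c) = 0 := by
  rw [negacyclicBCH, mem_negacyclicCode (bchGenerator_dvd_X_pow_add_one hint hβ hn hb),
    bchGenerator_dvd_iff hint]

theorem finrank_negacyclicBCH [Fintype F] (hβ : IsPrimitiveRoot β (2 * n))
    (hn : Fintype.card F + 1 = 2 * n) {b δ : ℕ} (hb : Odd b) (hbδ : ∀ t < δ - 1, b + 2 * t < n) :
    Module.finrank F (negacyclicBCH F n β b δ) + 2 * (δ - 1) = n := by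
  rw [← natDegree_bchGenerator hβ hn hb.pos hbδ]
  exact finrank_negacyclicCode (by omega)
    (bchGenerator_dvd_X_pow_add_one (isIntegral_pow hβ hn) hβ (by omega) hb)

theorem pow_sq_injective (hβ : IsPrimitiveRoot β (2 * n)) :
    Function.Injective fun t : Fin n => (β ^ 2) ^ (t : ℕ) := by
  intro t t' h
  simp only [← pow_mul] at h
  have := hβ.pow_inj (by omega) (by omega) h
  exact Fin.ext (by omega)

theorem two_le_hammingNorm [DecidableEq F] (hβ : IsPrimitiveRoot β (2 * n)) {c : Fin n → F}
    (hc : c ≠ 0) {j : ℕ} (h : aeval (β ^ j) (vecPoly c) = 0) : 2 ≤ hammingNorm c := by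
  classical
  have hn : n ≠ 0 := by
    rintro rfl
    exact hc (Subsingleton.elim _ _)
  have hβ0 : β ≠ 0 := hβ.ne_zero (by omega)
  have hinj : ∀ t : Fin n, Function.Injective fun x : F => algebraMap F K x * (β ^ j) ^ (t : ℕ) :=
    fun t x y hxy => (algebraMap F K).injective
      (mul_right_cancel₀ (pow_ne_zero _ (pow_ne_zero _ hβ0)) hxy)
  -- Rescaling coordinate `t` by `β ^ (j t)` keeps the weight and turns the root `β ^ j` into a
  -- vanishing zeroth moment.
  rw [← hammingNorm_comp (fun (t : Fin n) x => algebraMap F K x * (β ^ j) ^ (t : ℕ)) hinj (by simp)]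
  refine lt_hammingNorm_of_sum_mul_pow_eq_zero (pow_sq_injective hβ) ?_ ?_
  · obtain ⟨t, ht⟩ := Function.ne_iff.1 hc
    refine Function.ne_iff.2 ⟨t, mul_ne_zero ?_ (pow_ne_zero _ (pow_ne_zero _ hβ0))⟩
    simpa using ht
  · intro s hs
    obtain rfl : s = 0 := by omega
    rw [aeval_vecPoly] at h
    simpa using h

/-- The BCH bound, for a defining set that is closed under inversion. -/
theorem bch_bound [Fintype F] [DecidableEq F] (hβ : IsPrimitiveRoot β (2 * n))
    (hn : Fintype.card F + 1 = 2 * n) {c : Fin n → F} (hc : c ≠ 0) {m : ℕ}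
    (h : ∀ t < m, aeval (β ^ (1 + 2 * t)) (vecPoly c) = 0) : 2 * m < hammingNorm c := by
  classical
  have hβ0 : β ≠ 0 := hβ.ne_zero (by omega)
  have hinj : ∀ t : Fin n, Function.Injective
      fun x : F => algebraMap F K x * (β⁻¹ ^ (2 * m - 1)) ^ (t : ℕ) :=
    fun t x y hxy => (algebraMap F K).injective
      (mul_right_cancel₀ (pow_ne_zero _ (pow_ne_zero _ (inv_ne_zero hβ0))) hxy)
  rw [← hammingNorm_comp (fun (t : Fin n) x => algebraMap F K x * (β⁻¹ ^ (2 * m - 1)) ^ (t : ℕ)) hinj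
    (by simp)]
  refine lt_hammingNorm_of_sum_mul_pow_eq_zero (pow_sq_injective hβ) ?_ ?_
  · obtain ⟨t, ht⟩ := Function.ne_iff.1 hc
    refine Function.ne_iff.2 ⟨t, mul_ne_zero ?_ (pow_ne_zero _ (pow_ne_zero _ (inv_ne_zero hβ0)))⟩
    simpa using ht
  · intro s hs
    have hroot : aeval (β⁻¹ ^ (2 * m - 1) * (β ^ 2) ^ s) (vecPoly c) = 0 := by
      -- After the rescaling, the moment `s` is evaluation at `β ^ (2s - (2m - 1))`. For `s ≥ m`
      -- this is a given root, for `s < m` the inverse of one.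
      rcases le_or_gt m s with hms | hms
      · have : β⁻¹ ^ (2 * m - 1) * (β ^ 2) ^ s = β ^ (1 + 2 * (s - m)) := by
          rw [← pow_mul, show 2 * s = (2 * m - 1) + (1 + 2 * (s - m)) by omega, pow_add,
            ← mul_assoc, ← mul_pow, inv_mul_cancel₀ hβ0, one_pow, one_mul]
        rw [this]
        exact h _ (by omega)
      · have : β⁻¹ ^ (2 * m - 1) * (β ^ 2) ^ s = (β ^ (1 + 2 * (m - 1 - s)))⁻¹ := by
          rw [← pow_mul, show 2 * m - 1 = (1 + 2 * (m - 1 - s)) + 2 * s by omega, pow_add,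
            mul_assoc, ← mul_pow, inv_mul_cancel₀ hβ0, one_pow, mul_one, inv_pow]
        rw [this]
        exact aeval_inv_eq_zero (pow_eq_inv_of_add_one_eq hβ hn _) (h _ (by omega))
    rw [aeval_vecPoly] at hroot
    rw [← hroot]
    refine Finset.sum_congr rfl fun t _ => ?_
    rw [mul_pow, mul_assoc, pow_right_comm (β ^ 2) s]

end BCH

end ConvCode

/-! ### Assembly over the field with `q ^ 2` elements. -/

/-- The conclusion is the existence of an MDS convolutional code with the given parameters,
together with its origin: the code is the Hermitian dual of the code generated by
`H₁ + H₀ D` (with `H₀` padded by zero rows), where `H₁`, `H₀` and `H₁` stacked on `H₀` are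
parity-check matrices of the negacyclic BCH codes generated by `M^(1) M^(3) ⋯ M^(2i-3)`,
`M^(2i-1)` and `M^(1) M^(3) ⋯ M^(2i-1)`. -/
theorem theorem5 (p a q n i : ℕ) (hp : p.Prime) (hp2 : p ≠ 2) (ha : 1 ≤ a) (hq : q = p ^ a)
    (hn : n = (q ^ 2 + 1) / 2) (hi : 2 ≤ i) (hi' : i ≤ (n - 1) / 2)
    (F : Type*) [Field F] [Fintype F] (hF : Fintype.card F = q ^ 2) :
    ∃ V : Submodule F[X] (Fin n → F[X]),
      ConvCode.IsMDSConvolutionalCode V (n - 2 * i + 2) 2 1 (2 * i + 1) ∧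
      ∃ (β : AlgebraicClosure F) (H₁ : Matrix (Fin (2 * i - 2)) (Fin n) F)
        (H₀ : Matrix (Fin 2) (Fin n) F),
        IsPrimitiveRoot β (2 * n) ∧
        ConvCode.IsParityCheck H₁ (ConvCode.negacyclicBCH F n β 1 i) ∧
        ConvCode.IsParityCheck H₀ (ConvCode.negacyclicBCH F n β (2 * i - 1) 2) ∧
        ConvCode.IsParityCheck (Matrix.fromRows H₁ H₀) (ConvCode.negacyclicBCH F n β 1 (i + 1)) ∧
        V = ConvCode.hermitianDual q (ConvCode.generatedCode
          (ConvCode.unitMemoryMatrix H₁ (ConvCode.padRows (2 * i - 2) H₀))) := by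
  classical
  have hq2 : Odd q := hq ▸ (hp.odd_of_ne_two hp2).pow
  have hq0 : q ≠ 0 := hq2.pos.ne'
  have hcard : Fintype.card F + 1 = 2 * n := by
    obtain ⟨m, hm⟩ := hq2.pow (n := 2)
    omega
  -- In `F`, `2n = |F| + 1` equals one, so primitive `2n`-th roots of unity exist in the algebraic
  -- closure.
  have : NeZero ((2 * n : ℕ) : F) := ⟨by
    rw [← hcard, Nat.cast_add, FiniteField.cast_card_eq_zero]
    simp⟩
  obtain ⟨β, hβ⟩ := HasEnoughRootsOfUnity.exists_primitiveRoot (AlgebraicClosure F) (2 * n)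
  have hn0 : 0 < n := by omega
  have hint := ConvCode.isIntegral_pow (F := F) hβ hcard
  have hb : Odd (2 * i - 1) := ⟨i - 1, by omega⟩
  have hd₁ := ConvCode.finrank_negacyclicBCH (F := F) hβ hcard (b := 1) (δ := i) odd_one
    fun t ht => by omega
  have hd₀ := ConvCode.finrank_negacyclicBCH (F := F) hβ hcard (b := 2 * i - 1) (δ := 2) hb
    fun t ht => by omega
  have hdδ : ∀ t < i + 1 - 1, 1 + 2 * t < n := fun t ht => by omega
  have hd := ConvCode.finrank_negacyclicBCH (F := F) hβ hcard (b := 1) (δ := i + 1) odd_one hdδ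
  have hm₁ := ConvCode.mem_negacyclicBCH (F := F) (b := 1) (δ := i) hint hβ hn0 odd_one
  have hm₀ := ConvCode.mem_negacyclicBCH (F := F) (b := 2 * i - 1) (δ := 2) hint hβ hn0 hb
  have hm := ConvCode.mem_negacyclicBCH (F := F) (b := 1) (δ := i + 1) hint hβ hn0 odd_one
  have hinter : ∀ c, c ∈ ConvCode.negacyclicBCH F n β 1 (i + 1) ↔
      c ∈ ConvCode.negacyclicBCH F n β 1 i ∧ c ∈ ConvCode.negacyclicBCH F n β (2 * i - 1) 2 := by
    intro c
    rw [hm, hm₁, hm₀]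
    constructor
    · refine fun h => ⟨fun t ht => h t (by omega), fun t ht => ?_⟩
      rw [show 2 * i - 1 + 2 * t = 1 + 2 * (i - 1) by omega]
      exact h _ (by omega)
    · rintro ⟨h, h'⟩ t ht
      by_cases hti : t < i - 1
      · exact h t hti
      · rw [show 1 + 2 * t = 2 * i - 1 + 2 * 0 by omega]
        exact h' 0 (by omega)
  obtain ⟨H₁, hH₁⟩ := ConvCode.exists_isParityCheck (r := 2 * i - 2)
    (B := ConvCode.negacyclicBCH F n β 1 i) (by omega)
  obtain ⟨H₀, hH₀⟩ := ConvCode.exists_isParityCheck (r := 2)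
    (B := ConvCode.negacyclicBCH F n β (2 * i - 1) 2) (by omega)
  have hker : ∀ c, c ∈ ConvCode.negacyclicBCH F n β 1 (i + 1) ↔
      Matrix.mulVec (Matrix.fromRows H₁ H₀) c = 0 := by
    intro c
    rw [hinter, hH₁.2, hH₀.2, Matrix.fromRows_mulVec]
    constructor
    · rintro ⟨h, h'⟩
      rw [h, h']
      ext (_ | _) <;> rfl
    · exact fun h => ⟨funext fun j => congrFun h (Sum.inl j), funext fun j => congrFun h (Sum.inr j)⟩
  have hH : ConvCode.IsParityCheck (Matrix.fromRows H₁ H₀)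
      (ConvCode.negacyclicBCH F n β 1 (i + 1)) :=
    ⟨ConvCode.linearIndependent_row_of_finrank hker (by
      rw [Fintype.card_sum, Fintype.card_fin, Fintype.card_fin]
      omega), hker⟩
  refine ⟨_, ?_, β, H₁, H₀, hβ, hH₁, hH₀, hH, rfl⟩
  have : Fact p.Prime := ⟨hp⟩
  have : CharP F p := charP_of_card_eq_prime_pow (f := a * 2) (by rw [hF, hq, pow_mul])
  have hσ : ∀ x, iterateFrobenius F p a x = x ^ q := fun x => by rw [iterateFrobenius_def, hq]
  -- Conjugation `x ↦ x ^ q` is an involution because `q ^ 2 = |F|`; it also preserves Hamming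
  -- weights, so block distances carry over to the conjugate codes.
  have hσσ : ∀ x, iterateFrobenius F p a (iterateFrobenius F p a x) = x := fun x => by
    rw [hσ, hσ, ← pow_mul, ← sq, ← hF, FiniteField.pow_card]
  set σ := iterateFrobenius F p a
  have hpad : (ConvCode.padRows (2 * i - 2) H₀).map σ =
      ConvCode.padRows (2 * i - 2) (H₀.map σ) := by
    ext r c
    simp only [Matrix.map_apply, ConvCode.padRows]
    split_ifs <;> simp
  have hV : ∀ u, u ∈ ConvCode.hermitianDual q (ConvCode.generatedCode
      (ConvCode.unitMemoryMatrix H₁ (ConvCode.padRows (2 * i - 2) H₀))) ↔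
      Matrix.mulVec (ConvCode.unitMemoryMatrix (ConvCode.padRows (2 * i - 2) (H₀.map σ))
        (H₁.map σ)) u = 0 := fun u => by
    rw [ConvCode.mem_hermitianDual_unitMemoryMatrix hq0 hσ, hpad]
  have hli : LinearIndependent F (Matrix.fromRows (H₁.map σ) (H₀.map σ)).row := by
    rw [← Matrix.fromRows_map]
    exact ConvCode.linearIndependent_row_map hσσ hH.1
  have hnorm : ∀ c : Fin n → F, hammingNorm (σ ∘ c) = hammingNorm c := fun c =>
    hammingNorm_comp (fun _ => σ) (fun _ => σ.injective) (fun _ => map_zero σ)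
  have hne : ∀ c : Fin n → F, c ≠ 0 → σ ∘ c ≠ 0 := fun c hc h => hc (by
    rw [← hammingNorm_eq_zero, ← hnorm, h, hammingNorm_zero])
  refine ⟨⟨?_, ?_⟩, ?_⟩
  · rw [show n - 2 * i + 2 = 2 + (n - 2 * i) by omega]
    exact ConvCode.exists_isReducedBasic_of_kernel (by omega) two_pos (by omega) hli hV
  · refine ConvCode.hasFreeDistance_of_kernel (d₀ := 2) (d₁ := 2 * i - 1) (by omega) hV
      (fun c hc h => ?_) (fun c hc h => ?_) (fun c hc h h' => ?_) (by omega) ?_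
    · rw [ConvCode.map_mulVec_eq_zero_iff hσσ, ← hH₀.2, hm₀] at h
      rw [← hnorm]
      exact ConvCode.two_le_hammingNorm hβ (hne c hc) (h 0 (by omega))
    · rw [ConvCode.map_mulVec_eq_zero_iff hσσ, ← hH₁.2, hm₁] at h
      have := ConvCode.bch_bound hβ hcard (hne c hc) h
      rw [hnorm] at this
      omega
    · rw [ConvCode.map_mulVec_eq_zero_iff hσσ, ← hH₁.2] at h
      rw [ConvCode.map_mulVec_eq_zero_iff hσσ, ← hH₀.2] at h'
      have := ConvCode.bch_bound hβ hcard (hne c hc) ((hm _).1 ((hinter _).2 ⟨h, h'⟩))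
      rw [hnorm] at this
      omega
    · have hdeg := ConvCode.natDegree_bchGenerator (F := F) hβ hcard (b := 1) (δ := i + 1) one_pos
        hdδ
      obtain ⟨c, hc, hc0, hcw⟩ := ConvCode.exists_mem_hammingNorm_le (n := n)
        (g := ConvCode.bchGenerator F β 1 (i + 1)) (by
          intro h
          rw [h, Polynomial.natDegree_zero] at hdeg
          omega) (by omega)
        (ConvCode.bchGenerator_dvd_X_pow_add_one hint hβ hn0 odd_one)
      obtain ⟨h, h'⟩ := (hinter c).1 hc
      have hcc : σ ∘ (σ ∘ c) = c := funext fun j => hσσ _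
      refine ⟨σ ∘ c, hne c hc0, ?_, ?_, ?_⟩
      · rw [ConvCode.map_mulVec_eq_zero_iff hσσ, hcc, ← hH₁.2]
        exact h
      · rw [ConvCode.map_mulVec_eq_zero_iff hσσ, hcc, ← hH₀.2]
        exact h'
      · rw [hnorm]
        omega
  -- Since `k = n - 2i + 2 > 2 = γ`, the floor is zero and the bound reads `(2i - 2) + 2 + 1`.
  · rw [Nat.div_eq_of_lt (show 2 < n - 2 * i + 2 by omega)]
    omega
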